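/- Let $P(M,G)$ be a smooth principal bundle with projection $\mu:P\to M$ and right action $\kappa:P\times G\to P$ of the Lie group $G$ (finite-dimensional Hausdorff manifolds without boundary, everything $C^\infty$); write $\kappa_g=\kappa(\cdot,g)$, $\kappa_p=\kappa(p,\cdot)$, $pg=\kappa(p,g)$, and let $\pi^*:T^*P\to P$ be the cotangent bundle. Let $\mathrm{Aut}_0TP$ be the group of smooth vector bundle automorphisms $A$ of $TP$ covering $\mathrm{id}_P$, and let $\mathrm{Aut}_{TG}TP$ be the subgroup of those $A$ with $A(pg)\circ\Phi_{(g,X)}=\Phi_{(g,X)}\circ A(p)$ for all $p\in P$, $g\in G$, $X\in T_eG$, where $\Phi_{(g,X)}(v_p)=T\kappa_g(p)\bigl(v_p+T\kappa_p(e)X\bigr)$ is the action of $TG\cong G\ltimes T_eG$ on $TP$. A linear vector field on $T^*P$ is a pair of smooth vector fields $\xi$ on $T^*P$ and $\chi$ on $P$ such that $\xi:T^*P\to T(T^*P)$ is a morphism of vector bundles over $\chi:P\to TP$, where $T(T^*P)\to TP$ is the vector bundle with projection $T\pi^*$. A generalized canonical form is a smooth one-form $\gamma$ on $T^*P$ such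 that $\gamma_\varphi\neq0$ for every nonzero covector $\varphi$, $\ker T\pi^*(\varphi)\subset\ker\gamma_\varphi$ for every $\varphi\in T^*P$, and $\langle\gamma,\xi\rangle$ is a smooth fibrewise linear function for every linear vector field $(\xi,\chi)$; $\mathrm{Can}\,T^*P$ is the set of these forms. For $A\in\mathrm{Aut}_0TP$ let $A^*:T^*P\to T^*P$, $A^*\varphi=\varphi\circ A(\pi^*(\varphi))$, be its dual, and put $\langle\Theta(A)_\varphi,\xi_\varphi\rangle=\langle\varphi,A(\pi^*(\varphi))\,T\pi^*(\varphi)\xi_\varphi\rangle$ for $\xi_\varphi\in T_\varphi(T^*P)$, and $L^*_A\gamma=(A^*)^*\gamma$ for one-forms $\gamma$ on $T^*P$. The canonical form is $\gamma_0=\Theta(\mathrm{id})$. Put $\mathrm{Can}_{TG}T^*P=\Theta(\mathrm{Aut}_{TG}TP)$. Let $\Phi^*_g:T^*P\to T^*P$ be the cotangent lift of $\kappa_g$: for $p=\pi^*(\varphi)$, $\Phi^*_g(\varphi)$ is the covector $\varphi\circ (T\kappa_g(p))^{-1}$ at $pg$. For $X\in T_eG$ let $\xi^X$ be the fundamental vector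 field of this lifted action. Let $J_A:T^*P\to T_e^*G$, $\langle J_A(\varphi),X\rangle=\langle\Theta(A)_\varphi,\xi^X_\varphi\rangle$, be the momentum map given by the potential $\Theta(A)$ of $\omega_A=d\Theta(A)$, and let $J_0(\varphi)=\varphi\circ T\kappa_{\pi^*(\varphi)}(e)$ be the standard momentum map. Then, for every $A\in\mathrm{Aut}_0TP$, $\Theta(A)\in\mathrm{Can}\,T^*P$ and $J_A=J_0\circ A^*$; moreover: (i) For $A\in\mathrm{Aut}_0TP$: $\Theta(A)\in\mathrm{Can}_{TG}T^*P$ if and only if $(\Phi^*_g)^*\Theta(A)=\Theta(A)$ for all $g\in G$ and $J_A=J_0$. (ii) $L^*$ is a free left action of $\mathrm{Aut}_0TP$ on $\mathrm{Can}\,T^*P$, and $\mathrm{Can}_{TG}T^*P$ is the orbit $\{L^*_A\gamma_0: A\in\mathrm{Aut}_{TG}TP\}$ of $\gamma_0$ under the subgroup $\mathrm{Aut}_{TG}TP$. (iii) If $A\in\mathrm{Aut}_0TP$ and $L^*_A(\mathrm{Can}_{TG}T^*P)\subset\mathrm{Can}_{TG}T^*P$, then $A\in\mathrm{Aut}_{TG}TP$.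 -/

import Mathlib

open Bundle Manifold
open scoped ContDiff

noncomputable section

namespace GenCan

section General

variable {E : Type*} [NormedAddCommGroup E] [NormedSpace ℝ E]
  {H : Type*} [TopologicalSpace H] (I : ModelWithCorners ℝ E H)
  {X : Type*} [TopologicalSpace X] [ChartedSpace H X]
  {E' : Type*} [NormedAddCommGroup E'] [NormedSpace ℝ E']
  {H' : Type*} [TopologicalSpace H'] (I' : ModelWithCorners ℝ E' H')
  {Y : Type*} [TopologicalSpace Y] [ChartedSpace H' Y]

/-- The cotangent space `T*_x X`. -/
abbrev CotangentSpace (x : X) : Type _ := TangentSpace I x →L[ℝ] Trivial X ℝ x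

/-- The total space of the cotangent bundle `T*X`, with its vector bundle structure. -/
abbrev CotangentBundle (X : Type*) [TopologicalSpace X] [ChartedSpace H X]
    [IsManifold I 1 X] : Type _ :=
  TotalSpace (E →L[ℝ] ℝ) (fun x : X => CotangentSpace I x)

/-- The model of the manifold `T*X`. -/
abbrev cotModel : ModelWithCorners ℝ (E × (E →L[ℝ] ℝ)) (ModelProd H (E →L[ℝ] ℝ)) :=
  I.prod 𝓘(ℝ, E →L[ℝ] ℝ)

/-- (Not necessarily smooth) differential one-forms. -/
abbrev OneForm (X : Type*) [TopologicalSpace X] [ChartedSpace H X] : Type _ :=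
  (x : X) → TangentSpace I x →L[ℝ] ℝ

/-- (Not necessarily smooth) vector fields. -/
abbrev VField (X : Type*) [TopologicalSpace X] [ChartedSpace H X] : Type _ :=
  (x : X) → TangentSpace I x

variable {I I'}

/-- Smoothness of a one-form, as a section of the cotangent bundle. -/
def OneForm.IsSmooth [IsManifold I 1 X] (γ : OneForm I X) : Prop :=
  ContMDiff I (cotModel I) ∞ (fun x => (TotalSpace.mk x (γ x) : CotangentBundle I X))

/-- Smoothness of a vector field, as a section of the tangent bundle. -/
def VField.IsSmooth [IsManifold I 1 X] (χ : VField I X) : Prop :=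
  ContMDiff I I.tangent ∞ (fun x => (TotalSpace.mk x (χ x) : TangentBundle I X))

/-- The pullback `f^* γ` of a one-form. -/
def OneForm.pullback (f : X → Y) (γ : OneForm I' Y) : OneForm I X :=
  fun x => (γ (f x)).comp (mfderiv I I' f x)

end General

section Cotangent

variable {E : Type*} [NormedAddCommGroup E] [NormedSpace ℝ E]
  {H : Type*} [TopologicalSpace H] (I : ModelWithCorners ℝ E H)
  (P : Type*) [TopologicalSpace P] [ChartedSpace H P]

/-- The families of continuous linear automorphisms of the tangent spaces of `P`. -/
abbrev FibreAut : Type _ := (p : P) → TangentSpace I p ≃L[ℝ] TangentSpace I p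

variable {I P}

/-- `A(p)` depends smoothly on `p`: the section `A` of the bundle `End(TP)` is smooth. -/
def FibreAut.IsSmooth [IsManifold I 1 P] (A : FibreAut I P) : Prop :=
  ContMDiff I (I.prod 𝓘(ℝ, E →L[ℝ] E)) ∞
    (fun p => (TotalSpace.mk p (A p : TangentSpace I p →L[ℝ] TangentSpace I p) :
      TotalSpace (E →L[ℝ] E) (fun p : P => TangentSpace I p →L[ℝ] TangentSpace I p)))

theorem FibreAut.isSmooth_iff [IsManifold I ∞ P] {A : FibreAut I P} :
    A.IsSmooth ↔ ∀ p₀ : P, ContMDiffAt I 𝓘(ℝ, E →L[ℝ] E) ∞ (fun p =>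
      ContinuousLinearMap.inCoordinates E (TangentSpace I : P → Type _) E
        (TangentSpace I : P → Type _) p₀ p p₀ p
        (A p : TangentSpace I p →L[ℝ] TangentSpace I p)) p₀ := by
  unfold FibreAut.IsSmooth ContMDiff
  refine forall_congr' fun p₀ => ?_
  rw [contMDiffAt_hom_bundle]
  exact and_iff_right contMDiffAt_id

theorem FibreAut.eventually_inCoordinates [IsManifold I ∞ P] (p₀ : P) :
    ∀ᶠ p in nhds p₀, ∃ t : TangentSpace I p ≃L[ℝ] E,
      ∀ ϕ : TangentSpace I p →L[ℝ] TangentSpace I p,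
        ContinuousLinearMap.inCoordinates E (TangentSpace I : P → Type _) E
          (TangentSpace I : P → Type _) p₀ p p₀ p ϕ =
            (t : TangentSpace I p →L[ℝ] E).comp
              (ϕ.comp (t.symm : E →L[ℝ] TangentSpace I p)) := by
  filter_upwards [(trivializationAt E (TangentSpace I : P → Type _) p₀).open_baseSet.mem_nhds
    (FiberBundle.mem_baseSet_trivializationAt' p₀)] with p hp
  exact ⟨_, fun ϕ => ContinuousLinearMap.inCoordinates_eq hp hp⟩

theorem FibreAut.isSmooth_one [IsManifold I ∞ P] : (1 : FibreAut I P).IsSmooth := by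
  rw [FibreAut.isSmooth_iff]
  intro p₀
  refine (contMDiffAt_const (c := ContinuousLinearMap.id ℝ E)).congr_of_eventuallyEq ?_
  filter_upwards [FibreAut.eventually_inCoordinates (I := I) p₀] with p ⟨t, ht⟩
  rw [ht]
  ext v
  exact t.apply_symm_apply v

theorem FibreAut.IsSmooth.mul [IsManifold I ∞ P] {A B : FibreAut I P}
    (hA : A.IsSmooth) (hB : B.IsSmooth) : (A * B).IsSmooth := by
  rw [FibreAut.isSmooth_iff] at *
  intro p₀
  refine ((hA p₀).clm_comp (hB p₀)).congr_of_eventuallyEq ?_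
  filter_upwards [FibreAut.eventually_inCoordinates (I := I) p₀] with p ⟨t, ht⟩
  rw [ht, ht, ht]
  ext v
  change t (A p (B p (t.symm v))) = t (A p (t.symm (t (B p (t.symm v)))))
  rw [t.symm_apply_apply]

theorem FibreAut.IsSmooth.inv [FiniteDimensional ℝ E] [IsManifold I ∞ P] {A : FibreAut I P}
    (hA : A.IsSmooth) : (A⁻¹).IsSmooth := by
  have : CompleteSpace E := FiniteDimensional.complete ℝ E
  rw [FibreAut.isSmooth_iff] at *
  intro p₀
  have key : ∀ (p : P) (t : TangentSpace I p ≃L[ℝ] E),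
      (t : TangentSpace I p →L[ℝ] E).comp ((A p : TangentSpace I p →L[ℝ] TangentSpace I p).comp
        (t.symm : E →L[ℝ] TangentSpace I p)) =
      ((t.symm.trans ((A p).trans t) : E ≃L[ℝ] E) : E →L[ℝ] E) := fun p t => rfl
  have hinv : ContDiffAt ℝ ∞ ContinuousLinearMap.inverse
      (ContinuousLinearMap.inCoordinates E (TangentSpace I : P → Type _) E
        (TangentSpace I : P → Type _) p₀ p₀ p₀ p₀
        (A p₀ : TangentSpace I p₀ →L[ℝ] TangentSpace I p₀)) := by
    obtain ⟨t, ht⟩ := (FibreAut.eventually_inCoordinates (I := I) p₀).self_of_nhds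
    rw [ht, key]
    exact contDiffAt_map_inverse _
  refine (hinv.contMDiffAt.comp p₀ (hA p₀)).congr_of_eventuallyEq ?_
  filter_upwards [FibreAut.eventually_inCoordinates (I := I) p₀] with p ⟨t, ht⟩
  rw [Function.comp_apply, ht, ht, key, ContinuousLinearMap.inverse_equiv]
  rfl

variable (I P)

/-- The group `Aut₀ TP` of smooth automorphisms of `TP` covering the identity map of `P`. -/
def Aut0 [FiniteDimensional ℝ E] [IsManifold I ∞ P] : Subgroup (FibreAut I P) where
  carrier := {A | A.IsSmooth}
  one_mem' := FibreAut.isSmooth_one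
  mul_mem' := FibreAut.IsSmooth.mul
  inv_mem' := FibreAut.IsSmooth.inv

/-- The bundle projection `π^* : T*P → P`. -/
def cotProj [IsManifold I 1 P] : CotangentBundle I P → P := fun φ => φ.1

/-- The canonical one-form `γ₀` on `T*P`. -/
def canonicalForm [IsManifold I ∞ P] : OneForm (cotModel I) (CotangentBundle I P) :=
  fun φ => ContinuousLinearMap.comp φ.2 (mfderiv (cotModel I) I (cotProj I P) φ)

variable {I P}

/-- The one-form `Θ(A)` on `T*P`: `⟨Θ(A)_φ, ξ⟩ = ⟨φ, A(π^*(φ)) Tπ^*(φ) ξ⟩`. -/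
def Theta [IsManifold I ∞ P] (A : FibreAut I P) :
    OneForm (cotModel I) (CotangentBundle I P) :=
  fun φ => ContinuousLinearMap.comp φ.2
    ((A φ.1 : TangentSpace I φ.1 →L[ℝ] TangentSpace I φ.1).comp
      (mfderiv (cotModel I) I (cotProj I P) φ))

/-- The dual `A^* : T*P → T*P` of `A`. -/
def FibreAut.dual [IsManifold I 1 P] (A : FibreAut I P) :
    CotangentBundle I P → CotangentBundle I P :=
  fun φ => TotalSpace.mk φ.1
    (ContinuousLinearMap.comp φ.2 (A φ.1 : TangentSpace I φ.1 →L[ℝ] TangentSpace I φ.1))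

/-- `L^*_A γ`, the pullback of `γ` by `A^*`. -/
def Lstar [IsManifold I ∞ P] (A : FibreAut I P)
    (γ : OneForm (cotModel I) (CotangentBundle I P)) :
    OneForm (cotModel I) (CotangentBundle I P) :=
  OneForm.pullback A.dual γ

/-- The function `f` on `T*P` belongs to `Lin C^∞(T*P)`. -/
def IsLinFunction [IsManifold I ∞ P] (f : CotangentBundle I P → ℝ) : Prop :=
  ContMDiff (cotModel I) 𝓘(ℝ, ℝ) ∞ f ∧
    ∀ p : P, IsLinearMap ℝ (fun η : CotangentSpace I p => f (TotalSpace.mk p η))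

/-- The fibre coordinate `T*P → E*` of the preferred local trivialization of `T*P` at `p`. -/
def fibreCoord [IsManifold I ∞ P] (p : P) : CotangentBundle I P → (E →L[ℝ] ℝ) :=
  fun ψ => (trivializationAt (E →L[ℝ] ℝ) (fun x : P => CotangentSpace I x) p ψ).2

/-- `(ξ, χ)` is a linear vector field on `T*P`: the vector fields `ξ` and `χ` are smooth, and
`ξ : T*P → T(T*P)` is a morphism of vector bundles over `χ : P → TP`.  A local trivialization
`T*U ≅ U × E*` induces a local trivialization `T(T*U) ≅ TU × (E* × E*)` of the vector bundle
`Tπ^* : T(T*P) → TP`; in it `ξ` reads `φ ↦ (fibre coordinate of φ, its derivative along ξ)`,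
so that fibrewise linearity of `ξ` is linearity of the second component. -/
structure IsLinVField [IsManifold I ∞ P]
    (ξ : VField (cotModel I) (CotangentBundle I P)) (χ : VField I P) : Prop where
  smooth : ξ.IsSmooth
  smooth_base : χ.IsSmooth
  covers : ∀ φ : CotangentBundle I P, mfderiv (cotModel I) I (cotProj I P) φ (ξ φ) = χ φ.1
  linear : ∀ p : P, IsLinearMap ℝ (fun η : CotangentSpace I p =>
    (mfderiv (cotModel I) 𝓘(ℝ, E →L[ℝ] ℝ) (fibreCoord (I := I) p) (TotalSpace.mk p η)
      (ξ (TotalSpace.mk p η)) : E →L[ℝ] ℝ))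

/-- `γ` is a generalized canonical form on `T*P`. -/
structure IsGenCanonical [IsManifold I ∞ P]
    (γ : OneForm (cotModel I) (CotangentBundle I P)) : Prop where
  smooth : γ.IsSmooth
  /-- A fibrewise linear form vanishes on the zero section, so only `φ ≠ 0` is meant. -/
  ne_zero : ∀ φ : CotangentBundle I P, φ.2 ≠ 0 → γ φ ≠ 0
  ker_le : ∀ φ : CotangentBundle I P,
    LinearMap.ker (mfderiv (cotModel I) I (cotProj I P) φ).toLinearMap
      ≤ LinearMap.ker (γ φ).toLinearMap
  linear : ∀ ξ χ, IsLinVField ξ χ → IsLinFunction (fun φ => γ φ (ξ φ))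

variable (I P)

/-- The space `Can T*P` of generalized canonical forms. -/
def Can [IsManifold I ∞ P] : Set (OneForm (cotModel I) (CotangentBundle I P)) :=
  {γ | IsGenCanonical γ}

end Cotangent

/-- `L` restricts to a free left action of the subgroup `S` on the set `C`. -/
structure IsFreeActionOn {Γ X : Type*} [Group Γ] (S : Subgroup Γ) (C : Set X)
    (L : Γ → X → X) : Prop where
  maps : ∀ a ∈ S, ∀ x ∈ C, L a x ∈ C
  one : ∀ x ∈ C, L 1 x = x
  mul : ∀ a ∈ S, ∀ b ∈ S, ∀ x ∈ C, L (a * b) x = L a (L b x)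
  free : ∀ a ∈ S, ∀ x ∈ C, L a x = x → a = 1

section Principal

/-- A smooth principal `G`-bundle `μ : P → M` with right action `κ : P × G → P`. -/
structure PrincipalBundle
    {EP : Type*} [NormedAddCommGroup EP] [NormedSpace ℝ EP]
    {HP : Type*} [TopologicalSpace HP] (IP : ModelWithCorners ℝ EP HP)
    {EM : Type*} [NormedAddCommGroup EM] [NormedSpace ℝ EM]
    {HM : Type*} [TopologicalSpace HM] (IM : ModelWithCorners ℝ EM HM)
    {EG : Type*} [NormedAddCommGroup EG] [NormedSpace ℝ EG]
    {HG : Type*} [TopologicalSpace HG] (IG : ModelWithCorners ℝ EG HG)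
    (P : Type*) [TopologicalSpace P] [ChartedSpace HP P]
    (M : Type*) [TopologicalSpace M] [ChartedSpace HM M]
    (G : Type*) [TopologicalSpace G] [ChartedSpace HG G] [Group G] where
  /-- the bundle projection -/
  μ : P → M
  /-- the right action -/
  κ : P → G → P
  smooth_μ : ContMDiff IP IM ∞ μ
  smooth_κ : ContMDiff (IP.prod IG) IP ∞ (fun x : P × G => κ x.1 x.2)
  κ_one : ∀ p, κ p 1 = p
  κ_mul : ∀ p g h, κ p (g * h) = κ (κ p g) h
  /-- `G`-equivariant local trivializations `μ⁻¹(U) ≅ U × G` over `U` -/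
  locally_trivial : ∀ m : M, ∃ (U : Set M) (e : OpenPartialHomeomorph P (M × G)),
    IsOpen U ∧ m ∈ U ∧ e.source = μ ⁻¹' U ∧ e.target = U ×ˢ Set.univ ∧
    ContMDiffOn IP (IM.prod IG) ∞ e e.source ∧
    ContMDiffOn (IM.prod IG) IP ∞ e.symm e.target ∧
    (∀ p ∈ e.source, (e p).1 = μ p) ∧
    (∀ p ∈ e.source, ∀ g : G, e (κ p g) = ((e p).1, (e p).2 * g))

namespace PrincipalBundle

variable
    {EP : Type*} [NormedAddCommGroup EP] [NormedSpace ℝ EP]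
    {HP : Type*} [TopologicalSpace HP] {IP : ModelWithCorners ℝ EP HP}
    {EM : Type*} [NormedAddCommGroup EM] [NormedSpace ℝ EM]
    {HM : Type*} [TopologicalSpace HM] {IM : ModelWithCorners ℝ EM HM}
    {EG : Type*} [NormedAddCommGroup EG] [NormedSpace ℝ EG]
    {HG : Type*} [TopologicalSpace HG] {IG : ModelWithCorners ℝ EG HG}
    {P : Type*} [TopologicalSpace P] [ChartedSpace HP P]
    {M : Type*} [TopologicalSpace M] [ChartedSpace HM M]
    {G : Type*} [TopologicalSpace G] [ChartedSpace HG G] [Group G]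
    (B : PrincipalBundle IP IM IG P M G)

/-- `Tκ_g(p) : T_pP → T_{pg}P`. -/
def tangentRight (g : G) (p : P) : TangentSpace IP p →L[ℝ] TangentSpace IP (B.κ p g) :=
  mfderiv IP IP (fun q => B.κ q g) p

/-- `Tκ_p(e) : T_eG → T_pP`; here `κ_p(e) = p`. -/
def tangentOrbit (p : P) : GroupLieAlgebra IG G →L[ℝ] TangentSpace IP p :=
  (mfderiv IG IP (fun g => B.κ p g) (1 : G) :
    TangentSpace IG (1 : G) →L[ℝ] TangentSpace IP (B.κ p 1))

/-- The action `Φ_{(g,X)}(v_p) = Tκ_g(p)(v_p + Tκ_p(e)X)` of `TG ≅ G ⋉ T_eG` on `TP`. -/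
def tangentAction (g : G) (X : GroupLieAlgebra IG G) (p : P) (v : TangentSpace IP p) :
    TangentSpace IP (B.κ p g) :=
  B.tangentRight g p (v + B.tangentOrbit p X)

/-- The subgroup `Aut_{TG} TP` of those elements of `Aut₀ TP` that commute with the action of
`TG` on `TP`. -/
def AutTG [FiniteDimensional ℝ EP] [IsManifold IP ∞ P] : Subgroup (FibreAut IP P) where
  carrier := {A | A ∈ Aut0 IP P ∧ ∀ (g : G) (X : GroupLieAlgebra IG G) (p : P)
    (v : TangentSpace IP p),
    A (B.κ p g) (B.tangentAction g X p v) = B.tangentAction g X p (A p v)}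
  one_mem' := ⟨one_mem _, fun _ _ _ _ => rfl⟩
  mul_mem' := by
    rintro A A' ⟨h, h1⟩ ⟨h', h1'⟩
    refine ⟨mul_mem h h', fun g X p v => ?_⟩
    change A _ (A' _ _) = B.tangentAction g X p (A p (A' p v))
    rw [h1', h1]
  inv_mem' := by
    rintro A ⟨h, h1⟩
    refine ⟨inv_mem h, fun g X p v => ?_⟩
    change (A _).symm _ = B.tangentAction g X p ((A p).symm v)
    rw [ContinuousLinearEquiv.symm_apply_eq, h1, ContinuousLinearEquiv.apply_symm_apply]

/-- The cotangent lift `Φ^*_g : T*P → T*P`, `Φ^*_g(φ)(pg) = (Tκ_g(p)⁻¹)^* φ` with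
`p = π^*(φ)`. -/
def cotangentLift [IsManifold IP 1 P] (g : G) : CotangentBundle IP P → CotangentBundle IP P :=
  fun φ => TotalSpace.mk (B.κ φ.1 g)
    (ContinuousLinearMap.comp φ.2 (B.tangentRight g φ.1).inverse)

/-- The fundamental vector fields `ξ^X` of the lifted action: `X ↦ ξ^X_φ` is the derivative at
`e` of the orbit map `g ↦ Φ^*_g(φ)`; here `Φ^*_e(φ) = φ`. -/
def cotangentFundamental [IsManifold IP ∞ P] (φ : CotangentBundle IP P) :
    GroupLieAlgebra IG G →L[ℝ] TangentSpace (cotModel IP) φ :=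
  (mfderiv IG (cotModel IP) (fun g => B.cotangentLift g φ) (1 : G) :
    TangentSpace IG (1 : G) →L[ℝ] TangentSpace (cotModel IP) (B.cotangentLift 1 φ))

/-- The momentum map `T*P → T_e^*G` belonging to the potential `γ` of the symplectic form `dγ`:
`⟨J(φ), X⟩ = ⟨γ_φ, ξ^X_φ⟩`. -/
def momentumMap [IsManifold IP ∞ P] (γ : OneForm (cotModel IP) (CotangentBundle IP P)) :
    CotangentBundle IP P → (GroupLieAlgebra IG G →L[ℝ] ℝ) :=
  fun φ => (γ φ).comp (B.cotangentFundamental φ)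

/-- The standard momentum map `J₀(φ) = φ ∘ Tκ_{π^*(φ)}(e)`. -/
def J0 [IsManifold IP 1 P] : CotangentBundle IP P → (GroupLieAlgebra IG G →L[ℝ] ℝ) :=
  fun φ => ContinuousLinearMap.comp φ.2 (B.tangentOrbit φ.1)

/-- `Can_{TG} T*P = Θ(Aut_{TG} TP)`. -/
def CanTG [FiniteDimensional ℝ EP] [IsManifold IP ∞ P] :
    Set (OneForm (cotModel IP) (CotangentBundle IP P)) :=
  Theta '' (B.AutTG : Set (FibreAut IP P))

end PrincipalBundle

end Principal

end GenCan

end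

open GenCan

open Bundle Manifold
open scoped ContDiff

noncomputable section

namespace GenCan

/-! ### Smoothness of one-forms and vector fields on a manifold -/

section General

variable {E : Type*} [NormedAddCommGroup E] [NormedSpace ℝ E]
  {H : Type*} [TopologicalSpace H] {I : ModelWithCorners ℝ E H}
  {X : Type*} [TopologicalSpace X] [ChartedSpace H X]
  {E' : Type*} [NormedAddCommGroup E'] [NormedSpace ℝ E']
  {H' : Type*} [TopologicalSpace H'] {I' : ModelWithCorners ℝ E' H'}
  {Y : Type*} [TopologicalSpace Y] [ChartedSpace H' Y]

/-! Everything about `Theta` rests on two facts. Since `A^*` covers the identity of `P`, `Θ(A) =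
L^*_A γ₀` (`Lstar_canonicalForm`). Since `Tπ^*` is onto and covectors separate tangent vectors, `Θ`
is injective (`Theta_injective`), so that `Θ(A) ∈ Can_{TG}` exactly when `A ∈ Aut_{TG}`. The orbit
description in (ii) is the first fact, and (iii) follows from both by applying the inclusion to `γ₀
= Θ(1)`.

For (i), commuting with the `TG`-action splits into two conditions (`mem_AutTG_iff`): `X = 0` gives
commutation with every `Tκ_g`, and `g = e`, `v = 0` says that `A` fixes the vectors `Tκ_p(e)X`.
Tested against all covectors, the first is invariance of `Θ(A)` under the cotangent lifts
(`pullback_Theta_eq_iff`), the second is `J₀ ∘ A^* = J₀` (`momentumMap_Theta_eq_iff`).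

The action on all of `Can T*P` needs linear vector fields. They are stable under pushforward by
`A^*` (`IsLinVField.pushField`), so `L^*_A` preserves `Can T*P`. They attain every base vector
(`exists_isLinVField`), which gives freeness: if `L^*_A γ = γ`, then `⟨γ, ξ⟩` agrees at `φ` and
`A^*φ` by horizontality, hence vanishes at `A^*φ - φ` by linearity. Thus `γ` is zero at that
covector, which must therefore be zero. -/

theorem totalSpace_mk_congr {x y : X} (h : x = y) (w : E) :
    (TotalSpace.mk x w : TangentBundle I X) = TotalSpace.mk y w := by
  subst h; rfl

/-- All tangent spaces are copies of the model space, so a derivative can be moved along an equality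
of base points that is only propositional, such as `A^*((A⁻¹)^*φ) = φ`. -/
theorem mfderiv_congr_base (f : X → Y) {x y : X} (h : x = y) (w : E) :
    (mfderiv I I' f x : E →L[ℝ] E') w = (mfderiv I I' f y : E →L[ℝ] E') w := by
  subst h; rfl

/-- In the preferred trivializations a one-form is read by composing with the inverse of the
trivialization of the tangent bundle. -/
theorem OneForm.isSmooth_iff [IsManifold I 1 X] {γ : OneForm I X} :
    γ.IsSmooth ↔ ∀ x₀ : X, ContMDiffAt I 𝓘(ℝ, E →L[ℝ] ℝ) ∞ (fun x =>
      (γ x).comp ((trivializationAt E (TangentSpace I : X → Type _) x₀).symmL ℝ x)) x₀ := by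
  unfold OneForm.IsSmooth ContMDiff
  refine forall_congr' fun x₀ => ?_
  rw [contMDiffAt_hom_bundle]
  refine (and_iff_right contMDiffAt_id).trans (iff_of_eq ?_)
  congr 1
  ext x v
  simp [ContinuousLinearMap.inCoordinates]

theorem OneForm.IsSmooth.pullback [IsManifold I ∞ X] [IsManifold I' ∞ Y] {γ : OneForm I' Y}
    (hγ : γ.IsSmooth) {f : X → Y} (hf : ContMDiff I I' ∞ f) :
    (OneForm.pullback f γ : OneForm I X).IsSmooth := by
  rw [OneForm.isSmooth_iff] at hγ ⊢
  intro x₀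
  have h1 := (hγ (f x₀)).comp x₀ hf.contMDiffAt
  have h2 := (hf.contMDiffAt (x := x₀)).mfderiv_const (m := ∞) le_rfl
  refine (h1.clm_comp h2).congr_of_eventuallyEq ?_
  filter_upwards [hf.continuous.continuousAt.preimage_mem_nhds
    ((trivializationAt E' (TangentSpace I' : Y → Type _) (f x₀)).open_baseSet.mem_nhds
      (FiberBundle.mem_baseSet_trivializationAt' (f x₀)))] with x hx
  ext v
  simp only [OneForm.pullback, Function.comp_apply, inTangentCoordinates,
    ContinuousLinearMap.inCoordinates, ContinuousLinearMap.comp_apply, id]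
  rw [Trivialization.symmL_continuousLinearMapAt _ hx]

theorem OneForm.IsSmooth.apply [IsManifold I 1 X] {γ : OneForm I X} (hγ : γ.IsSmooth)
    {ξ : VField I X} (hξ : ξ.IsSmooth) : ContMDiff I 𝓘(ℝ, ℝ) ∞ (fun x => γ x (ξ x)) := by
  intro x
  have h := ContMDiff.clm_bundle_apply (B := X) (M := X) (IM := I) (IB := I) (n := ∞) (F₁ := E)
    (F₂ := ℝ) (E₁ := fun x => TangentSpace I x) (E₂ := Trivial X ℝ) (b := fun x => x)
    (ϕ := γ) (v := ξ) hγ hξ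
  exact (contMDiffAt_totalSpace.1 (h x)).2

end General

/-! ### Fibre coordinates on `T*P`, the dual `A^*` and the form `Θ(A)` -/

section Cotangent

variable {E : Type*} [NormedAddCommGroup E] [NormedSpace ℝ E]
  {H : Type*} [TopologicalSpace H] {I : ModelWithCorners ℝ E H}
  {P : Type*} [TopologicalSpace P] [ChartedSpace H P] [IsManifold I ∞ P]
  {EN : Type*} [NormedAddCommGroup EN] [NormedSpace ℝ EN]
  {HN : Type*} [TopologicalSpace HN] {IN : ModelWithCorners ℝ EN HN}
  {N : Type*} [TopologicalSpace N] [ChartedSpace HN N]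

theorem fibreCoord_eq (q : P) (ψ : CotangentBundle I P) :
    fibreCoord q ψ = ContinuousLinearMap.comp ψ.2
      ((trivializationAt E (TangentSpace I : P → Type _) q).symmL ℝ ψ.1) := by
  ext v
  simp [fibreCoord, hom_trivializationAt_apply, ContinuousLinearMap.inCoordinates]

theorem contMDiffAt_cotangent {f : N → CotangentBundle I P} {x₀ : N} :
    ContMDiffAt IN (cotModel I) ∞ f x₀ ↔ ContMDiffAt IN I ∞ (fun x => (f x).1) x₀ ∧
      ContMDiffAt IN 𝓘(ℝ, E →L[ℝ] ℝ) ∞ (fun x => fibreCoord (f x₀).1 (f x)) x₀ :=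
  contMDiffAt_totalSpace

theorem contMDiff_cotProj : ContMDiff (cotModel I) I ∞ (cotProj I P) :=
  contMDiff_proj _

theorem mdifferentiableAt_cotProj (φ : CotangentBundle I P) :
    MDifferentiableAt (cotModel I) I (cotProj I P) φ :=
  contMDiff_cotProj.mdifferentiableAt (by simp)

theorem contMDiffAt_fibreCoord {q : P} {ψ : CotangentBundle I P}
    (hψ : ψ.1 ∈ (trivializationAt E (TangentSpace I : P → Type _) q).baseSet) :
    ContMDiffAt (cotModel I) 𝓘(ℝ, E →L[ℝ] ℝ) ∞ (fibreCoord q) ψ := by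
  have h := (trivializationAt (E →L[ℝ] ℝ) (fun x : P => CotangentSpace I x) q).contMDiffAt_iff
    (IM := cotModel I) (IB := I) (n := ∞) (f := (id : CotangentBundle I P → _)) (x₀ := ψ) (by
      rw [hom_trivializationAt_source]; exact ⟨hψ, trivial⟩)
  exact (h.1 contMDiffAt_id).2

theorem eventually_mem_baseSet {q : P} {ψ : CotangentBundle I P}
    (hψ : ψ.1 ∈ (trivializationAt E (TangentSpace I : P → Type _) q).baseSet) :
    ∀ᶠ ψ' in nhds ψ, ψ'.1 ∈ (trivializationAt E (TangentSpace I : P → Type _) q).baseSet :=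
  (contMDiff_cotProj (I := I) (P := P)).continuous.continuousAt.preimage_mem_nhds
    ((trivializationAt E (TangentSpace I : P → Type _) q).open_baseSet.mem_nhds hψ)

/-- The endomorphism `A(p)` read in the preferred trivialization of `TP` at `q`. -/
def FibreAut.coord (A : FibreAut I P) (q p : P) : E →L[ℝ] E :=
  ((trivializationAt E (TangentSpace I : P → Type _) q).continuousLinearMapAt ℝ p).comp
    ((A p : TangentSpace I p →L[ℝ] TangentSpace I p).comp
      ((trivializationAt E (TangentSpace I : P → Type _) q).symmL ℝ p))

theorem FibreAut.IsSmooth.coord {A : FibreAut I P} (hA : A.IsSmooth) (q : P) :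
    ContMDiffAt I 𝓘(ℝ, E →L[ℝ] E) ∞ (A.coord q) q :=
  FibreAut.isSmooth_iff.1 hA q

theorem fibreCoord_dual (A : FibreAut I P) {q : P} {ψ : CotangentBundle I P}
    (hψ : ψ.1 ∈ (trivializationAt E (TangentSpace I : P → Type _) q).baseSet) :
    fibreCoord q (A.dual ψ) = (fibreCoord q ψ).comp (A.coord q ψ.1) := by
  rw [fibreCoord_eq, fibreCoord_eq]
  refine ContinuousLinearMap.ext fun v => ?_
  exact congrArg ψ.2 (Trivialization.symmL_continuousLinearMapAt (R := ℝ) _ hψ _).symm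

theorem FibreAut.IsSmooth.dual {A : FibreAut I P} (hA : A.IsSmooth) :
    ContMDiff (cotModel I) (cotModel I) ∞ A.dual := by
  intro ψ
  rw [contMDiffAt_cotangent]
  refine ⟨contMDiff_cotProj ψ, ?_⟩
  have hψ := FiberBundle.mem_baseSet_trivializationAt' (F := E)
    (E := (TangentSpace I : P → Type _)) ψ.1
  refine ((contMDiffAt_fibreCoord hψ).clm_comp
    ((hA.coord ψ.1).comp ψ (contMDiff_cotProj ψ))).congr_of_eventuallyEq ?_
  filter_upwards [eventually_mem_baseSet hψ] with ψ' h'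
  exact fibreCoord_dual A h'

theorem FibreAut.IsSmooth.mdifferentiableAt_dual {A : FibreAut I P} (hA : A.IsSmooth)
    (ψ : CotangentBundle I P) : MDifferentiableAt (cotModel I) (cotModel I) A.dual ψ :=
  hA.dual.mdifferentiableAt (by simp)

theorem dual_one : (1 : FibreAut I P).dual = id := rfl

/-- Dualizing reverses products. Pullback reverses them again, which makes `L^*` a left action. -/
theorem dual_mul (A B : FibreAut I P) (φ : CotangentBundle I P) :
    (A * B).dual φ = B.dual (A.dual φ) := rfl

theorem dual_dual_inv (A : FibreAut I P) (φ : CotangentBundle I P) :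
    A.dual (A⁻¹.dual φ) = φ := by
  rw [← dual_mul, inv_mul_cancel, dual_one, id]

theorem dual_inv_dual (A : FibreAut I P) (φ : CotangentBundle I P) :
    A⁻¹.dual (A.dual φ) = φ := by
  rw [← dual_mul, mul_inv_cancel, dual_one, id]

theorem mfderiv_cotProj_dual {A : FibreAut I P} (hA : A.IsSmooth) (φ : CotangentBundle I P)
    (w : TangentSpace (cotModel I) φ) :
    mfderiv (cotModel I) I (cotProj I P) (A.dual φ)
      (mfderiv (cotModel I) (cotModel I) A.dual φ w) =
    mfderiv (cotModel I) I (cotProj I P) φ w := by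
  have h := mfderiv_comp φ (mdifferentiableAt_cotProj (A.dual φ)) (hA.mdifferentiableAt_dual φ)
  have h' : cotProj I P ∘ A.dual = cotProj I P := rfl
  rw [h'] at h
  exact (congrArg (fun T => T w) h).symm

theorem Lstar_canonicalForm {A : FibreAut I P} (hA : A.IsSmooth) :
    Lstar A (canonicalForm I P) = Theta A := by
  funext φ
  ext w
  exact congrArg (fun u => φ.2 (A φ.1 u)) (mfderiv_cotProj_dual hA φ w)

theorem Theta_one : Theta (1 : FibreAut I P) = canonicalForm I P := rfl

/-- In coordinates `γ₀` is the fibre coordinate composed with the coordinate expression of `Tπ^*`,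
both smooth in `φ`. -/
theorem isSmooth_canonicalForm : (canonicalForm I P).IsSmooth := by
  rw [OneForm.isSmooth_iff]
  intro φ
  have hφ := FiberBundle.mem_baseSet_trivializationAt' (F := E)
    (E := (TangentSpace I : P → Type _)) φ.1
  refine ((contMDiffAt_fibreCoord hφ).clm_comp
    ((contMDiff_cotProj (I := I) (P := P) φ).mfderiv_const
      (m := ∞) le_rfl)).congr_of_eventuallyEq ?_
  filter_upwards [eventually_mem_baseSet hφ] with ψ hψ
  rw [fibreCoord_eq]
  refine ContinuousLinearMap.ext fun v => ?_
  exact congrArg ψ.2 (Trivialization.symmL_continuousLinearMapAt (R := ℝ) _ hψ _).symm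

theorem FibreAut.IsSmooth.Theta {A : FibreAut I P} (hA : A.IsSmooth) :
    (Theta A).IsSmooth := by
  rw [← Lstar_canonicalForm hA]
  exact isSmooth_canonicalForm.pullback hA.dual

end Cotangent

/-! ### Derivatives of vector valued functions; vector fields constant in a chart -/

section General

variable {E : Type*} [NormedAddCommGroup E] [NormedSpace ℝ E]
  {H : Type*} [TopologicalSpace H] {I : ModelWithCorners ℝ E H}
  {X : Type*} [TopologicalSpace X] [ChartedSpace H X]

section Deriv

variable {F : Type*} [NormedAddCommGroup F] [NormedSpace ℝ F]
  {W : Type*} [NormedAddCommGroup W] [NormedSpace ℝ W]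
  {E' : Type*} [NormedAddCommGroup E'] [NormedSpace ℝ E']
  {H' : Type*} [TopologicalSpace H'] {I' : ModelWithCorners ℝ E' H'}
  {Y : Type*} [TopologicalSpace Y] [ChartedSpace H' Y]

variable (I) in
/-- The derivative of a vector valued function along a tangent vector. -/
def vderiv (f : X → F) {x : X} (w : TangentSpace I x) : F :=
  mfderiv I 𝓘(ℝ, F) f x w

theorem vderiv_smul (f : X → F) {x : X} (a : ℝ) (w : TangentSpace I x) :
    vderiv I f (a • w) = a • vderiv I f w :=
  (mfderiv I 𝓘(ℝ, F) f x : E →L[ℝ] F).map_smul a w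

theorem vderiv_prodMk {f : X → F} {g : X → W} {x : X} (w : TangentSpace I x)
    (hf : MDifferentiableAt I 𝓘(ℝ, F) f x) (hg : MDifferentiableAt I 𝓘(ℝ, W) g x) :
    vderiv I (fun y => (f y, g y)) w = (vderiv I f w, vderiv I g w) := by
  have h : HasMFDerivAt I 𝓘(ℝ, F × W) (fun y => (f y, g y)) x
      (ContinuousLinearMap.prod (mfderiv I 𝓘(ℝ, F) f x : E →L[ℝ] F)
        (mfderiv I 𝓘(ℝ, W) g x : E →L[ℝ] W)) :=
    ⟨hf.hasMFDerivAt.1.prodMk hg.hasMFDerivAt.1, hf.hasMFDerivAt.2.prodMk hg.hasMFDerivAt.2⟩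
  exact congrArg (fun T : E →L[ℝ] F × W => T w) h.mfderiv

theorem vderiv_congr {f g : X → F} {x : X} (h : f =ᶠ[nhds x] g) {w : TangentSpace I x} :
    vderiv I f w = vderiv I g w := by
  unfold vderiv
  rw [h.mfderiv_eq]
  rfl

theorem vderiv_clm_apply {C : X → F →L[ℝ] W} {u : X → F} {x : X} (w : TangentSpace I x)
    (hC : MDifferentiableAt I 𝓘(ℝ, F →L[ℝ] W) C x) (hu : MDifferentiableAt I 𝓘(ℝ, F) u x) :
    vderiv I (fun y => C y (u y)) w = vderiv I C w (u x) + C x (vderiv I u w) := by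
  have h3 := (isBoundedBilinearMap_apply (𝕜 := ℝ) (E := F) (F := W)).hasFDerivAt (C x, u x)
  have h4 := h3.hasMFDerivAt.comp (f := fun y => (C y, u y)) x
    ⟨hC.hasMFDerivAt.1.prodMk hu.hasMFDerivAt.1, hC.hasMFDerivAt.2.prodMk hu.hasMFDerivAt.2⟩
  refine (congrArg (fun T : E →L[ℝ] W => T w) h4.mfderiv).trans ?_
  exact add_comm _ _

theorem vderiv_comp {f : Y → F} {g : X → Y} {x : X} (w : TangentSpace I x)
    (hf : MDifferentiableAt I' 𝓘(ℝ, F) f (g x)) (hg : MDifferentiableAt I I' g x) :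
    vderiv I (f ∘ g) w = vderiv I' f (mfderiv I I' g x w) := by
  unfold vderiv
  rw [mfderiv_comp x hf hg]
  rfl

/-- Composition with a fixed endomorphism, as an endomorphism of the dual space. -/
def precompL : (F →L[ℝ] F) →L[ℝ] (F →L[ℝ] ℝ) →L[ℝ] (F →L[ℝ] ℝ) :=
  (ContinuousLinearMap.compL ℝ F F ℝ).flip

theorem mdifferentiableAt_precompL {n : WithTop ℕ∞} {B : X → F →L[ℝ] F} {x : X}
    (hB : ContMDiffAt I 𝓘(ℝ, F →L[ℝ] F) n B x) (hn : n ≠ 0) :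
    MDifferentiableAt I 𝓘(ℝ, (F →L[ℝ] ℝ) →L[ℝ] (F →L[ℝ] ℝ))
      (fun y => GenCan.precompL (B y)) x := by
  have h : ContMDiffAt 𝓘(ℝ, F →L[ℝ] F) 𝓘(ℝ, (F →L[ℝ] ℝ) →L[ℝ] (F →L[ℝ] ℝ)) n
    (GenCan.precompL (F := F)) (B x) := ContinuousLinearMap.contMDiffAt _
  exact (h.comp x hB).mdifferentiableAt hn

end Deriv

variable [IsManifold I ∞ X]

variable (I) in
/-- The vector field that is constant, with value `v`, in the chart at `x₀`. -/
def chartField (x₀ : X) (v : E) : VField I X :=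
  fun x => (trivializationAt E (TangentSpace I : X → Type _) x₀).symmL ℝ x v

theorem contMDiffOn_chartField (x₀ : X) (v : E) :
    ContMDiffOn I I.tangent ∞
      (fun x => (TotalSpace.mk x (chartField I x₀ v x) : TangentBundle I X))
      (chartAt H x₀).source := by
  have h := (trivializationAt E (TangentSpace I : X → Type _) x₀).contMDiffOn_section_baseSet_iff
    (IB := I) (n := ∞) (s := chartField I x₀ v)
  refine h.2 ((contMDiffOn_const (c := v)).congr fun x hx => ?_)
  have := Trivialization.continuousLinearMapAt_symmL (R := ℝ)
    (trivializationAt E (TangentSpace I : X → Type _) x₀) hx v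
  rwa [Trivialization.continuousLinearMapAt_apply, Trivialization.linearMapAt_apply,
    if_pos hx] at this

theorem mfderiv_extChartAt_chartField (x₀ : X) (v : E) {x : X} (hx : x ∈ (chartAt H x₀).source) :
    mfderiv I 𝓘(ℝ, E) (extChartAt I x₀) x (chartField I x₀ v x) = v := by
  rw [← TangentBundle.continuousLinearMapAt_trivializationAt hx]
  exact Trivialization.continuousLinearMapAt_symmL (R := ℝ)
    (trivializationAt E (TangentSpace I : X → Type _) x₀) hx v

theorem chartField_mfderiv_extChartAt (x₀ : X) {x : X} (hx : x ∈ (chartAt H x₀).source)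
    (w : TangentSpace I x) :
    chartField I x₀ (mfderiv I 𝓘(ℝ, E) (extChartAt I x₀) x w) x = w := by
  rw [← TangentBundle.continuousLinearMapAt_trivializationAt hx]
  exact Trivialization.symmL_continuousLinearMapAt (R := ℝ)
    (trivializationAt E (TangentSpace I : X → Type _) x₀) hx w

end General

/-! ### Pushforward of linear vector fields by `A^*` -/

section Cotangent

variable {E : Type*} [NormedAddCommGroup E] [NormedSpace ℝ E]
  {H : Type*} [TopologicalSpace H] {I : ModelWithCorners ℝ E H}
  {P : Type*} [TopologicalSpace P] [ChartedSpace H P] [IsManifold I ∞ P]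
  {W : Type*} [NormedAddCommGroup W] [NormedSpace ℝ W]

/-- The derivative of a fibrewise linear function along a family of vectors on a fibre that is
linear in one trivialization depends linearly on the point of the fibre. -/
theorem isLinearMap_mfderiv {p q : P}
    (hp : p ∈ (trivializationAt E (TangentSpace I : P → Type _) q).baseSet)
    {w : (η : CotangentSpace I p) → TangentSpace (cotModel I) (TotalSpace.mk p η :
      CotangentBundle I P)} {c : TangentSpace I p}
    (hw : ∀ η, mfderiv (cotModel I) I (cotProj I P) (TotalSpace.mk p η) (w η) = c)
    (hlin : IsLinearMap ℝ (fun η => vderiv (cotModel I) (fibreCoord (I := I) q) (w η)))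
    {C : P → (E →L[ℝ] ℝ) →L[ℝ] W} (hC : MDifferentiableAt I 𝓘(ℝ, (E →L[ℝ] ℝ) →L[ℝ] W) C p)
    {f : CotangentBundle I P → W}
    (hf : ∀ᶠ p' in nhds p, ∀ η : CotangentSpace I p',
      f (TotalSpace.mk p' η) = C p' (fibreCoord q (TotalSpace.mk p' η))) :
    IsLinearMap ℝ (fun η => vderiv (cotModel I) f (w η)) := by
  -- Product rule for `f = C · fibreCoord`: the first term is linear in `η` because the base
  -- velocity `c` is the same along the whole fibre, the second by `hlin`.
  have key : ∀ η : CotangentSpace I p, vderiv (cotModel I) f (w η) =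
      vderiv I C c (ContinuousLinearMap.comp η
        ((trivializationAt E (TangentSpace I : P → Type _) q).symmL ℝ p)) +
      C p (vderiv (cotModel I) (fibreCoord q) (w η)) := by
    intro η
    have hev : f =ᶠ[nhds (TotalSpace.mk p η : CotangentBundle I P)]
        fun ψ' => C ψ'.1 (fibreCoord q ψ') :=
      ((contMDiff_cotProj (I := I) (P := P)).continuous.continuousAt.eventually hf).mono
        fun ψ' h => h ψ'.2
    have hC' : MDifferentiableAt I 𝓘(ℝ, (E →L[ℝ] ℝ) →L[ℝ] W) C
      (cotProj I P (TotalSpace.mk p η)) := hC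
    have h := vderiv_clm_apply (I := cotModel I) (w η)
      (hC'.comp _ (mdifferentiableAt_cotProj (TotalSpace.mk p η)))
      ((contMDiffAt_fibreCoord (ψ := TotalSpace.mk p η) hp).mdifferentiableAt (by simp))
    rw [vderiv_comp (w η) hC' (mdifferentiableAt_cotProj (TotalSpace.mk p η)), hw η,
      fibreCoord_eq] at h
    rw [vderiv_congr hev]
    exact h
  simp only [key]
  constructor
  · intro η η'
    rw [hlin.map_add, map_add, ContinuousLinearMap.add_comp, map_add]
    abel
  · intro a η
    rw [hlin.map_smul, map_smul, ContinuousLinearMap.smul_comp, map_smul, smul_add]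

/-- The vector field `A^*_* ξ` on `T*P`. -/
def pushField (A : FibreAut I P) (ξ : VField (cotModel I) (CotangentBundle I P)) :
    VField (cotModel I) (CotangentBundle I P) :=
  fun ψ => (mfderiv (cotModel I) (cotModel I) A.dual (A⁻¹.dual ψ) (ξ (A⁻¹.dual ψ)) :
    E × (E →L[ℝ] ℝ))

theorem pushField_dual (A : FibreAut I P) (ξ : VField (cotModel I) (CotangentBundle I P))
    (φ : CotangentBundle I P) :
    pushField A ξ (A.dual φ) = mfderiv (cotModel I) (cotModel I) A.dual φ (ξ φ) := by
  unfold pushField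
  generalize hx : A⁻¹.dual (A.dual φ) = x
  obtain rfl : x = φ := by rw [← hx, dual_inv_dual]
  rfl

theorem mfderiv_pushField {F : Type*} [NormedAddCommGroup F] [NormedSpace ℝ F]
    {H' : Type*} [TopologicalSpace H'] {I' : ModelWithCorners ℝ F H'}
    {Y : Type*} [TopologicalSpace Y] [ChartedSpace H' Y]
    {A : FibreAut I P} (hA : A.IsSmooth) (ξ : VField (cotModel I) (CotangentBundle I P))
    (ψ : CotangentBundle I P) {f : CotangentBundle I P → Y}
    (hf : MDifferentiableAt (cotModel I) I' f ψ) :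
    (mfderiv (cotModel I) I' f ψ (pushField A ξ ψ) : F) =
      mfderiv (cotModel I) I' (f ∘ A.dual) (A⁻¹.dual ψ) (ξ (A⁻¹.dual ψ)) := by
  have h := dual_dual_inv A ψ
  have hf' : MDifferentiableAt (cotModel I) I' f (A.dual (A⁻¹.dual ψ)) := by rwa [h]
  rw [mfderiv_comp _ hf' (hA.mdifferentiableAt_dual _)]
  exact mfderiv_congr_base f h.symm _

theorem IsLinVField.pushField {A : FibreAut I P} (hA : A.IsSmooth) (hA' : (A⁻¹).IsSmooth)
    {ξ : VField (cotModel I) (CotangentBundle I P)} {χ : VField I P} (h : IsLinVField ξ χ) :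
    IsLinVField (pushField A ξ) χ where
  smooth := by
    have h1 := (hA.dual.contMDiff_tangentMap (m := ∞) le_rfl).comp (h.smooth.comp hA'.dual)
    refine h1.congr fun ψ => ?_
    exact (totalSpace_mk_congr (dual_dual_inv A ψ) _).symm
  smooth_base := h.smooth_base
  covers ψ := (mfderiv_pushField hA ξ ψ (mdifferentiableAt_cotProj ψ)).trans
    (h.covers (A⁻¹.dual ψ))
  linear p := by
    change IsLinearMap ℝ (fun η : CotangentSpace I p => vderiv (cotModel I)
      (fibreCoord (I := I) p) (GenCan.pushField A ξ (TotalSpace.mk p η)))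
    have hp := FiberBundle.mem_baseSet_trivializationAt' (F := E)
      (E := (TangentSpace I : P → Type _)) p
    -- In the trivialization at `p`, `A^*` acts on fibre coordinates by precomposition with `A.coord
    -- p`, so `fibreCoord p ∘ A.dual` is fibrewise linear with smooth coefficients.
    have hlin := isLinearMap_mfderiv (q := p) hp
      (w := fun η => ξ (TotalSpace.mk p η)) (c := χ p) (fun η => h.covers _) (h.linear p)
      (C := fun p' => precompL (A.coord p p'))
      (mdifferentiableAt_precompL (hA.coord p) (by simp))
      (f := fibreCoord p ∘ A.dual) (by
        filter_upwards [(trivializationAt E (TangentSpace I : P → Type _) p).open_baseSet.mem_nhds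
          hp] with p' hp' η
        exact fibreCoord_dual A (ψ := TotalSpace.mk p' η) hp')
    -- The pushed field at `η` comes from `ξ` at `η ∘ A(p)⁻¹`, which is linear in `η`.
    have key : ∀ η : CotangentSpace I p,
        vderiv (cotModel I) (fibreCoord (I := I) p) (GenCan.pushField A ξ (TotalSpace.mk p η)) =
        vderiv (cotModel I) (fibreCoord (I := I) p ∘ A.dual)
          (ξ (TotalSpace.mk p (ContinuousLinearMap.comp η
            (A⁻¹ p : TangentSpace I p →L[ℝ] TangentSpace I p)))) := fun η =>
      mfderiv_pushField hA ξ (TotalSpace.mk p η)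
        ((contMDiffAt_fibreCoord (ψ := TotalSpace.mk p η) hp).mdifferentiableAt (by simp))
    simp only [key]
    constructor
    · intro η η'
      rw [ContinuousLinearMap.add_comp]
      exact hlin.map_add _ _
    · intro a η
      rw [ContinuousLinearMap.smul_comp]
      exact hlin.map_smul _ _

end Cotangent

/-! ### Existence of linear vector fields with a prescribed base vector -/

section Cotangent

variable {E : Type*} [NormedAddCommGroup E] [NormedSpace ℝ E]
  {H : Type*} [TopologicalSpace H] {I : ModelWithCorners ℝ E H}
  {P : Type*} [TopologicalSpace P] [ChartedSpace H P] [IsManifold I ∞ P]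

theorem mem_chartAt_cotangent_source {ψ φ : CotangentBundle I P} :
    ψ ∈ (chartAt (ModelProd H (E →L[ℝ] ℝ)) φ).source ↔ ψ.1 ∈ (chartAt H φ.1).source := by
  rw [FiberBundle.chartedSpace_chartAt]
  simp [hom_trivializationAt_apply]

theorem extChartAt_cotangent (φ : CotangentBundle I P) :
    (extChartAt (cotModel I) φ : CotangentBundle I P → E × (E →L[ℝ] ℝ)) =
      fun ψ => (extChartAt I φ.1 (cotProj I P ψ), fibreCoord φ.1 ψ) := by
  rw [FiberBundle.extChartAt]
  rfl

theorem vderiv_extChartAt_cotangent {φ ψ : CotangentBundle I P}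
    (h : ψ.1 ∈ (chartAt H φ.1).source) (w : TangentSpace (cotModel I) ψ) :
    vderiv (cotModel I) (extChartAt (cotModel I) φ) w =
      (vderiv I (extChartAt I φ.1) (mfderiv (cotModel I) I (cotProj I P) ψ w),
        vderiv (cotModel I) (fibreCoord φ.1) w) := by
  have h1 : MDifferentiableAt I 𝓘(ℝ, E) (extChartAt I φ.1) (cotProj I P ψ) :=
    mdifferentiableAt_extChartAt h
  have h2 : MDifferentiableAt (cotModel I) 𝓘(ℝ, E →L[ℝ] ℝ) (fibreCoord φ.1) ψ :=
    (contMDiffAt_fibreCoord h).mdifferentiableAt (by simp)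
  rw [extChartAt_cotangent, ← vderiv_comp w h1 (mdifferentiableAt_cotProj ψ)]
  exact vderiv_prodMk w (h1.comp ψ (mdifferentiableAt_cotProj ψ)) h2

theorem vderiv_fibreCoord_chartField (p : P) (v : E) {ψ : CotangentBundle I P}
    (h : ψ.1 ∈ (chartAt H p).source) :
    vderiv (cotModel I) (fibreCoord (I := I) p)
      (chartField (cotModel I) (TotalSpace.mk p 0 : CotangentBundle I P) (v, 0) ψ) = 0 := by
  have h1 := vderiv_extChartAt_cotangent (φ := TotalSpace.mk p 0) h
    (chartField (cotModel I) (TotalSpace.mk p 0 : CotangentBundle I P) (v, 0) ψ)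
  have h2 := mfderiv_extChartAt_chartField (I := cotModel I)
    (TotalSpace.mk p 0 : CotangentBundle I P) (v, 0)
    (mem_chartAt_cotangent_source.2 h)
  exact congrArg Prod.snd (h1.symm.trans h2)

theorem mfderiv_cotProj_chartField (p : P) (v : E) {ψ : CotangentBundle I P}
    (h : ψ.1 ∈ (chartAt H p).source) :
    mfderiv (cotModel I) I (cotProj I P) ψ
      (chartField (cotModel I) (TotalSpace.mk p 0 : CotangentBundle I P) (v, 0) ψ) =
      chartField I p v ψ.1 := by
  have h1 := vderiv_extChartAt_cotangent (φ := TotalSpace.mk p 0) h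
    (chartField (cotModel I) (TotalSpace.mk p 0 : CotangentBundle I P) (v, 0) ψ)
  have h2 := mfderiv_extChartAt_chartField (I := cotModel I)
    (TotalSpace.mk p 0 : CotangentBundle I P) (v, 0)
    (mem_chartAt_cotangent_source.2 h)
  have h3 := congrArg Prod.fst (h1.symm.trans h2)
  have h4 := chartField_mfderiv_extChartAt p h (mfderiv (cotModel I) I (cotProj I P) ψ
      (chartField (cotModel I) (TotalSpace.mk p 0 : CotangentBundle I P) (v, 0) ψ))
  exact h4.symm.trans (congrArg (fun u : E => chartField I p u ψ.1) h3)

/-- `IsLinVField` tests linearity at each point in the trivialization centred there. This transition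
formula carries linearity over from another trivialization. -/
theorem fibreCoord_change {q r p : P}
    (hq : p ∈ (trivializationAt E (TangentSpace I : P → Type _) q).baseSet)
    (hr : p ∈ (trivializationAt E (TangentSpace I : P → Type _) r).baseSet)
    (η : CotangentSpace I p) :
    fibreCoord r (TotalSpace.mk p η) = precompL
      ((trivializationAt E (TangentSpace I : P → Type _) r).coordChangeL ℝ
        (trivializationAt E (TangentSpace I : P → Type _) q) p : E →L[ℝ] E)
      (fibreCoord q (TotalSpace.mk p η)) := by
  rw [fibreCoord_eq, fibreCoord_eq]
  refine ContinuousLinearMap.ext fun v => ?_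
  have h : (trivializationAt E (TangentSpace I : P → Type _) r).coordChangeL ℝ
      (trivializationAt E (TangentSpace I : P → Type _) q) p v =
      (trivializationAt E (TangentSpace I : P → Type _) q).continuousLinearMapAt ℝ p
        ((trivializationAt E (TangentSpace I : P → Type _) r).symmL ℝ p v) := by
    rw [Trivialization.coordChangeL_apply _ _ ⟨hr, hq⟩, Trivialization.continuousLinearMapAt_apply,
      Trivialization.linearMapAt_apply, if_pos hq, Trivialization.symmL_apply _ hr]
  refine congrArg η ?_
  have h' := Trivialization.symmL_continuousLinearMapAt (R := ℝ)
    (trivializationAt E (TangentSpace I : P → Type _) q) hq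
    ((trivializationAt E (TangentSpace I : P → Type _) r).symmL ℝ p v)
  rw [← h] at h'
  exact h'.symm

variable [FiniteDimensional ℝ E] [T2Space P]

/-- In the chart at `p`, take the field with constant base velocity `u` (the coordinates of `v`) and
zero fibre velocity, and cut it off by a bump function pulled back from `P`. Such a cutoff is
constant on fibres and so keeps the field linear. -/
theorem exists_isLinVField (p : P) (v : TangentSpace I p) :
    ∃ ξ : VField (cotModel I) (CotangentBundle I P), ∃ χ : VField I P,
      IsLinVField ξ χ ∧ χ p = v := by
  obtain ⟨ρ⟩ : Nonempty (SmoothBumpFunction I p) := inferInstance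
  let u : E := mfderiv I 𝓘(ℝ, E) (extChartAt I p) p v
  let φ₀ : CotangentBundle I P := TotalSpace.mk p 0
  have hp := mem_chart_source H p
  refine ⟨fun ψ => ρ ψ.1 • chartField (cotModel I) φ₀ (u, 0) ψ, fun x => ρ x • chartField I p u x,
    ⟨?_, ?_, ?_, ?_⟩, ?_⟩
  · refine ContMDiffOn.smul_section_of_tsupport (u := cotProj I P ⁻¹' (chartAt H p).source)
      (ψ := fun ψ : CotangentBundle I P => ρ ψ.1) ?_ ?_ ?_ ?_
    · exact (ρ.contMDiff.comp contMDiff_cotProj).contMDiffOn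
    · exact (chartAt H p).open_source.preimage contMDiff_cotProj.continuous
    · exact (tsupport_comp_subset_preimage ρ contMDiff_cotProj.continuous).trans
        (Set.preimage_mono ρ.tsupport_subset_chartAt_source)
    · exact (contMDiffOn_chartField φ₀ (u, 0)).mono
        fun ψ hψ => mem_chartAt_cotangent_source.2 hψ
  · exact ContMDiffOn.smul_section_of_tsupport ρ.contMDiff.contMDiffOn (chartAt H p).open_source
      ρ.tsupport_subset_chartAt_source (contMDiffOn_chartField p u)
  · intro ψ
    refine ((mfderiv (cotModel I) I (cotProj I P) ψ).map_smul _ _).trans ?_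
    by_cases h : ψ.1 ∈ (chartAt H p).source
    · exact congrArg (fun w : E => ρ ψ.1 • w) (mfderiv_cotProj_chartField p u h)
    · have h0 : ρ ψ.1 = 0 := Function.notMem_support.1 fun h' => h (ρ.support_subset_source h')
      simp only [h0]
      exact (zero_smul ℝ (_ : E)).trans (zero_smul ℝ (_ : E)).symm
  · intro q
    change IsLinearMap ℝ (fun η : CotangentSpace I q => vderiv (cotModel I)
      (fibreCoord (I := I) q)
      (ρ q • chartField (cotModel I) φ₀ (u, 0) (TotalSpace.mk q η)))
    by_cases h : q ∈ (chartAt H p).source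
    -- The fibre velocity vanishes in the trivialization at `p`. In the one at `q` it need not,
    -- since the transition map varies with the base point, but that contribution is linear in `η`.
    · refine isLinearMap_mfderiv (p := q) (q := p) (c := ρ q • chartField I p u q)
        (C := fun x => precompL
          ((trivializationAt E (TangentSpace I : P → Type _) q).coordChangeL ℝ
            (trivializationAt E (TangentSpace I : P → Type _) p) x : E →L[ℝ] E)) h ?_ ?_ ?_ ?_
      · intro η
        refine ((mfderiv (cotModel I) I (cotProj I P) (TotalSpace.mk q η)).map_smul _ _).trans ?_
        exact congrArg (fun w : E => ρ q • w) (mfderiv_cotProj_chartField p u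
          (ψ := TotalSpace.mk q η) h)
      · have h0 (η : CotangentSpace I q) := vderiv_fibreCoord_chartField p u
          (ψ := TotalSpace.mk q η) h
        simp only [vderiv_smul, φ₀, h0, smul_zero]
        exact (0 : CotangentSpace I q →ₗ[ℝ] (E →L[ℝ] ℝ)).isLinear
      · exact mdifferentiableAt_precompL (contMDiffAt_coordChangeL (n := ∞)
          (FiberBundle.mem_baseSet_trivializationAt' q) h) (by simp)
      · filter_upwards [(trivializationAt E (TangentSpace I : P → Type _) p).open_baseSet.mem_nhds
          h, (trivializationAt E (TangentSpace I : P → Type _) q).open_baseSet.mem_nhds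
          (FiberBundle.mem_baseSet_trivializationAt' q)] with x hx hx' η
        exact fibreCoord_change hx hx' η
    · have h0 : ρ q = 0 := Function.notMem_support.1 fun h' => h (ρ.support_subset_source h')
      have h1 (η : CotangentSpace I q) : vderiv (cotModel I) (fibreCoord (I := I) q)
          (ρ q • chartField (cotModel I) φ₀ (u, 0) (TotalSpace.mk q η)) = 0 := by
        refine (vderiv_smul _ _ _).trans ?_
        rw [h0, zero_smul]
      simp only [h1]
      exact (0 : CotangentSpace I q →ₗ[ℝ] (E →L[ℝ] ℝ)).isLinear
  · have h1 : chartField I p u p = v := chartField_mfderiv_extChartAt p hp v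
    simp only [ρ.eq_one, h1]
    exact one_smul ℝ (v : E)

end Cotangent

/-! ### The space `Can T*P` and the free action `L^*` -/

section Cotangent

variable {E : Type*} [NormedAddCommGroup E] [NormedSpace ℝ E]
  {H : Type*} [TopologicalSpace H] {I : ModelWithCorners ℝ E H}
  {P : Type*} [TopologicalSpace P] [ChartedSpace H P]

theorem ext_of_forall_cotangent {p : P} {v w : TangentSpace I p}
    (h : ∀ η : CotangentSpace I p, η v = η w) : v = w :=
  (SeparatingDual.eq_iff_forall_dual_eq (R := ℝ) (V := E)).2 h

variable [IsManifold I ∞ P]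

theorem Theta_apply (A : FibreAut I P) (φ : CotangentBundle I P)
    (w : TangentSpace (cotModel I) φ) :
    Theta A φ w = φ.2 (A φ.1 (mfderiv (cotModel I) I (cotProj I P) φ w)) := rfl

theorem Lstar_apply (A : FibreAut I P) (γ : OneForm (cotModel I) (CotangentBundle I P))
    (φ : CotangentBundle I P) (w : TangentSpace (cotModel I) φ) :
    Lstar A γ φ w = γ (A.dual φ) (mfderiv (cotModel I) (cotModel I) A.dual φ w) := rfl

theorem Lstar_one (γ : OneForm (cotModel I) (CotangentBundle I P)) :
    Lstar (1 : FibreAut I P) γ = γ := by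
  funext φ
  refine ContinuousLinearMap.ext fun w => ?_
  rw [Lstar_apply, dual_one, mfderiv_id]
  rfl

theorem Lstar_mul {A B : FibreAut I P} (hA : A.IsSmooth) (hB : B.IsSmooth)
    (γ : OneForm (cotModel I) (CotangentBundle I P)) :
    Lstar (A * B) γ = Lstar A (Lstar B γ) := by
  funext φ
  refine ContinuousLinearMap.ext fun w => ?_
  have h := mfderiv_comp φ (hB.mdifferentiableAt_dual (A.dual φ)) (hA.mdifferentiableAt_dual φ)
  exact congrArg (fun T => γ (B.dual (A.dual φ)) (T w)) h

/-- Horizontal forms depend only on the projection of a tangent vector. -/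
theorem IsGenCanonical.apply_eq {γ : OneForm (cotModel I) (CotangentBundle I P)}
    (hγ : IsGenCanonical γ) {φ : CotangentBundle I P} {w w' : TangentSpace (cotModel I) φ}
    (h : mfderiv (cotModel I) I (cotProj I P) φ w = mfderiv (cotModel I) I (cotProj I P) φ w') :
    γ φ w = γ φ w' := by
  have h1 : w - w' ∈ LinearMap.ker (γ φ).toLinearMap := hγ.ker_le φ (by
    refine (ContinuousLinearMap.map_sub (mfderiv (cotModel I) I (cotProj I P) φ) w w').trans ?_
    exact sub_eq_zero.2 h)
  exact sub_eq_zero.1 ((ContinuousLinearMap.map_sub (γ φ) w w').symm.trans h1)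

variable [FiniteDimensional ℝ E]

theorem Lstar_isGenCanonical {A : FibreAut I P} (hA : A.IsSmooth)
    {γ : OneForm (cotModel I) (CotangentBundle I P)} (hγ : IsGenCanonical γ) :
    IsGenCanonical (Lstar A γ) where
  smooth := hγ.smooth.pullback hA.dual
  ne_zero φ hφ h := by
    have h1 : (A.dual φ).2 ≠ 0 := fun h0 => hφ <| ContinuousLinearMap.ext fun v => by
      have h2 : φ.2 (A φ.1 ((A φ.1).symm v)) = 0 :=
        congrArg (fun T => T ((A φ.1).symm v)) h0
      rwa [ContinuousLinearEquiv.apply_symm_apply] at h2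
    refine hγ.ne_zero _ h1 (ContinuousLinearMap.ext fun w => ?_)
    -- Differentiating `A^* ∘ (A⁻¹)^* = id` writes every vector at `A^*φ` as an image under `TA^*`,
    -- so `γ` would vanish at `A^*φ` if `L^*_A γ` vanished at `φ`.
    have hid := mfderiv_comp (A.dual φ) (hA.mdifferentiableAt_dual (A⁻¹.dual (A.dual φ)))
      (hA.inv.mdifferentiableAt_dual (A.dual φ))
    have hid' : A.dual ∘ A⁻¹.dual = id := funext (dual_dual_inv A)
    rw [hid', mfderiv_id] at hid
    have h3 := congrArg (fun T : E × (E →L[ℝ] ℝ) →L[ℝ] E × (E →L[ℝ] ℝ) => T w) hid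
    have h4 := mfderiv_congr_base (I := cotModel I) (I' := cotModel I) A.dual (dual_inv_dual A φ)
      (mfderiv (cotModel I) (cotModel I) A⁻¹.dual (A.dual φ) w)
    have h5 : w = mfderiv (cotModel I) (cotModel I) A.dual φ
      (mfderiv (cotModel I) (cotModel I) A⁻¹.dual (A.dual φ) w : E × (E →L[ℝ] ℝ)) := h3.trans h4
    rw [h5]
    exact congrArg (fun T : E × (E →L[ℝ] ℝ) →L[ℝ] ℝ =>
      T (mfderiv (cotModel I) (cotModel I) A⁻¹.dual (A.dual φ) w)) h
  ker_le φ w hw := by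
    refine hγ.ker_le (A.dual φ) ?_
    exact (mfderiv_cotProj_dual hA φ w).trans hw
  linear ξ χ h := by
    have h1 := hγ.linear _ _ (h.pushField hA hA.inv)
    -- A fibrewise linear function composed with the fibrewise linear map `A^*`.
    have h2 : (fun φ => Lstar A γ φ (ξ φ)) = (fun φ => γ φ (pushField A ξ φ)) ∘ A.dual := by
      funext φ
      rw [Lstar_apply, Function.comp_apply, pushField_dual]
    rw [h2]
    refine ⟨h1.1.comp hA.dual, fun p => ⟨fun η η' => ?_, fun a η => ?_⟩⟩
    · exact (congrArg (fun ζ => γ (TotalSpace.mk p ζ) (pushField A ξ (TotalSpace.mk p ζ)))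
        (ContinuousLinearMap.add_comp η η' (A p : TangentSpace I p →L[ℝ] TangentSpace I p))).trans
        ((h1.2 p).map_add _ _)
    · exact (congrArg (fun ζ => γ (TotalSpace.mk p ζ) (pushField A ξ (TotalSpace.mk p ζ)))
        (ContinuousLinearMap.smul_comp a η (A p : TangentSpace I p →L[ℝ] TangentSpace I p))).trans
        ((h1.2 p).map_smul _ _)

variable [T2Space P]

theorem mfderiv_cotProj_surjective (φ : CotangentBundle I P) :
    Function.Surjective (mfderiv (cotModel I) I (cotProj I P) φ) := fun v => by
  obtain ⟨ξ, χ, h, hv⟩ := exists_isLinVField φ.1 v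
  exact ⟨ξ φ, (h.covers φ).trans hv⟩

theorem Theta_injective : Function.Injective (Theta : FibreAut I P → _) := by
  intro A B h
  funext p
  refine ContinuousLinearEquiv.ext (funext fun v => ext_of_forall_cotangent fun η => ?_)
  obtain ⟨w, hw⟩ := mfderiv_cotProj_surjective (TotalSpace.mk p η : CotangentBundle I P) v
  have h1 := congrArg (fun γ => γ (TotalSpace.mk p η) w) h
  simp only [Theta_apply, hw] at h1
  exact h1

theorem Theta_isGenCanonical {A : FibreAut I P} (hA : A.IsSmooth) :
    IsGenCanonical (Theta A) where
  smooth := hA.Theta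
  ne_zero φ hφ h := hφ <| ContinuousLinearMap.ext fun v => by
    obtain ⟨w, hw⟩ := mfderiv_cotProj_surjective φ ((A φ.1).symm v)
    have h1 : Theta A φ w = 0 := congrArg (fun T => T w) h
    rw [Theta_apply, hw, ContinuousLinearEquiv.apply_symm_apply] at h1
    exact h1
  ker_le φ w hw := by
    have hw' : mfderiv (cotModel I) I (cotProj I P) φ w = 0 := hw
    change Theta A φ w = 0
    rw [Theta_apply, hw']
    exact (congrArg φ.2 (A φ.1).map_zero).trans (ContinuousLinearMap.map_zero φ.2)
  linear ξ χ h := by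
    refine ⟨hA.Theta.apply h.smooth, fun p => ?_⟩
    have h1 : ∀ η : CotangentSpace I p, Theta A (TotalSpace.mk p η) (ξ (TotalSpace.mk p η)) =
        η (A p (χ p)) := fun η => by
      rw [Theta_apply, h.covers]
    simp only [h1]
    exact ⟨fun _ _ => rfl, fun _ _ => rfl⟩

/-- A form in `Can T*P` separates the points of the fibres of `T*P`. -/
theorem eq_one_of_Lstar_eq {A : FibreAut I P} (hA : A.IsSmooth)
    {γ : OneForm (cotModel I) (CotangentBundle I P)} (hγ : IsGenCanonical γ)
    (h : Lstar A γ = γ) : A = 1 := by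
  have key : ∀ (p : P) (η : CotangentSpace I p),
      ContinuousLinearMap.comp η (A p : TangentSpace I p →L[ℝ] TangentSpace I p) = η := by
    intro p η
    set η' : CotangentSpace I p :=
      ContinuousLinearMap.comp η (A p : TangentSpace I p →L[ℝ] TangentSpace I p) with hη'
    rw [← sub_eq_zero]
    by_contra hne
    refine hγ.ne_zero (TotalSpace.mk p (η' - η)) hne (ContinuousLinearMap.ext fun w => ?_)
    obtain ⟨ξ, χ, hξ, hv⟩ := exists_isLinVField p
      (mfderiv (cotModel I) I (cotProj I P) (TotalSpace.mk p (η' - η)) w)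
    have h0 : γ (TotalSpace.mk p (η' - η)) w =
        γ (TotalSpace.mk p (η' - η)) (ξ (TotalSpace.mk p (η' - η))) :=
      hγ.apply_eq (((hξ.covers _).trans hv).symm)
    -- At `η' = A^*η` the vectors `ξ` and `TA^* ξ` both project to `χ(p)`, and a horizontal form
    -- cannot distinguish them.
    have h1 : γ (TotalSpace.mk p η') (ξ (TotalSpace.mk p η')) =
        γ (TotalSpace.mk p η) (ξ (TotalSpace.mk p η)) := by
      have h2 := congrArg (fun γ => γ (TotalSpace.mk p η) (ξ (TotalSpace.mk p η))) h
      refine Eq.trans ?_ h2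
      refine hγ.apply_eq ((hξ.covers _).trans ?_)
      exact ((mfderiv_cotProj_dual hA (TotalSpace.mk p η) _).trans (hξ.covers _)).symm
    rw [h0]
    have h3 := ((hγ.linear ξ χ hξ).2 p).map_sub η' η
    exact h3.trans (sub_eq_zero.2 h1)
  funext p
  refine ContinuousLinearEquiv.ext (funext fun v => ext_of_forall_cotangent fun η => ?_)
  exact congrArg (fun T => T v) (key p η)

end Cotangent

/-! ### Cotangent lifts, momentum maps and `TG`-equivariance -/

namespace PrincipalBundle

variable
    {EP : Type*} [NormedAddCommGroup EP] [NormedSpace ℝ EP]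
    {HP : Type*} [TopologicalSpace HP] {IP : ModelWithCorners ℝ EP HP}
    {EM : Type*} [NormedAddCommGroup EM] [NormedSpace ℝ EM]
    {HM : Type*} [TopologicalSpace HM] {IM : ModelWithCorners ℝ EM HM}
    {EG : Type*} [NormedAddCommGroup EG] [NormedSpace ℝ EG]
    {HG : Type*} [TopologicalSpace HG] {IG : ModelWithCorners ℝ EG HG}
    {P : Type*} [TopologicalSpace P] [ChartedSpace HP P]
    {M : Type*} [TopologicalSpace M] [ChartedSpace HM M]
    {G : Type*} [TopologicalSpace G] [ChartedSpace HG G] [Group G]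
    (B : PrincipalBundle IP IM IG P M G)

theorem contMDiff_right (g : G) : ContMDiff IP IP ∞ (fun q => B.κ q g) :=
  B.smooth_κ.comp (contMDiff_id.prodMk contMDiff_const)

theorem mdifferentiableAt_right (g : G) (p : P) :
    MDifferentiableAt IP IP (fun q => B.κ q g) p :=
  (B.contMDiff_right g).mdifferentiableAt (by simp)

theorem right_inv_right (p : P) (g : G) : B.κ (B.κ p g) g⁻¹ = p := by
  rw [← B.κ_mul, mul_inv_cancel, B.κ_one]

theorem right_right_inv (p : P) (g : G) : B.κ (B.κ p g⁻¹) g = p := by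
  rw [← B.κ_mul, inv_mul_cancel, B.κ_one]

/-- `Tκ_g(p)` as an isomorphism, with inverse `Tκ_{g⁻¹}(pg)`. -/
def tangentRightEquiv (g : G) (p : P) : TangentSpace IP p ≃L[ℝ] TangentSpace IP (B.κ p g) :=
  ContinuousLinearEquiv.equivOfInverse (M₁ := EP) (M₂ := EP) (B.tangentRight g p)
    (B.tangentRight g⁻¹ (B.κ p g))
    (fun v => by
      have h := mfderiv_comp p (B.mdifferentiableAt_right g⁻¹ (B.κ p g))
        (B.mdifferentiableAt_right g p)
      have h' : (fun q => B.κ q g⁻¹) ∘ (fun q => B.κ q g) = id :=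
        funext fun q => B.right_inv_right q g
      rw [h', mfderiv_id] at h
      exact (congrArg (fun T : EP →L[ℝ] EP => T v) h).symm)
    (fun v => by
      have h := mfderiv_comp (B.κ p g) (B.mdifferentiableAt_right g (B.κ (B.κ p g) g⁻¹))
        (B.mdifferentiableAt_right g⁻¹ (B.κ p g))
      have h' : (fun q => B.κ q g) ∘ (fun q => B.κ q g⁻¹) = id :=
        funext fun q => B.right_right_inv q g
      rw [h', mfderiv_id] at h
      have h1 := congrArg (fun T : EP →L[ℝ] EP => T v) h
      exact (h1.trans (mfderiv_congr_base (E := EP) (E' := EP)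
        (fun q => B.κ q g) (B.right_inv_right p g)
        ((mfderiv IP IP (fun q => B.κ q g⁻¹) (B.κ p g) : EP →L[ℝ] EP) v))).symm)

theorem coe_tangentRightEquiv (g : G) (p : P) :
    (B.tangentRightEquiv g p : TangentSpace IP p →L[ℝ] TangentSpace IP (B.κ p g)) =
      B.tangentRight g p := rfl

/-- `ContinuousLinearMap.inverse` is zero on non-invertible maps; here it is the genuine inverse. -/
theorem tangentRight_inverse (g : G) (p : P) :
    (B.tangentRight g p).inverse = (B.tangentRightEquiv g p).symm := by
  rw [← coe_tangentRightEquiv, ContinuousLinearMap.inverse_equiv]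

theorem tangentAction_zero (g : G) (p : P) (v : TangentSpace IP p) :
    B.tangentAction g (0 : GroupLieAlgebra IG G) p v = B.tangentRight g p v := by
  unfold tangentAction
  rw [ContinuousLinearMap.map_zero, add_zero]

variable [IsManifold IP ∞ P]

theorem cotangentLift_one (φ : CotangentBundle IP P) : B.cotangentLift (1 : G) φ = φ := by
  -- The map `κ_e` is replaced by a variable `f` so that `f = id` can be substituted in the
  -- dependent types.
  have h : ∀ f : P → P, f = id → (TotalSpace.mk (f φ.1)
      (ContinuousLinearMap.comp φ.2 (mfderiv IP IP f φ.1).inverse) : CotangentBundle IP P) = φ := by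
    rintro f rfl
    rw [mfderiv_id, ContinuousLinearMap.inverse_id]
    rfl
  exact h (fun q => B.κ q 1) (funext B.κ_one)

variable [FiniteDimensional ℝ EP]
  {EN : Type*} [NormedAddCommGroup EN] [NormedSpace ℝ EN]
  {HN : Type*} [TopologicalSpace HN] {IN : ModelWithCorners ℝ EN HN}
  {N : Type*} [TopologicalSpace N] [ChartedSpace HN N] [IsManifold IN ∞ N]

/-- Letting `g` and `φ` vary together covers both the lifts `Φ^*_g` and the orbit maps `g ↦
Φ^*_g(φ)`. In coordinates the lift is precomposition with the inverse of the matrix of `Tκ_g`, and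
inversion is smooth at invertible maps. -/
theorem contMDiff_cotangentLift_comp {h : N → G} (hh : ContMDiff IN IG ∞ h)
    {w : N → CotangentBundle IP P} (hw : ContMDiff IN (cotModel IP) ∞ w) :
    ContMDiff IN (cotModel IP) ∞ (fun n => B.cotangentLift (h n) (w n)) := by
  intro n₀
  have : CompleteSpace EP := FiniteDimensional.complete ℝ EP
  have hb : ContMDiff IN IP ∞ (fun n => (w n).1) := contMDiff_cotProj.comp hw
  have hκ : ContMDiff IN IP ∞ (fun n => B.κ (w n).1 (h n)) :=
    B.smooth_κ.comp (hb.prodMk hh)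
  rw [contMDiffAt_cotangent]
  refine ⟨hκ n₀, ?_⟩
  have hD := ContMDiffAt.mfderiv (J := IN) (I := IP) (I' := IP) (m := ∞) (n := ∞) (x₀ := n₀)
    (fun n q => B.κ q (h n)) (fun n => (w n).1)
    ((B.smooth_κ.comp (contMDiff_snd.prodMk (hh.comp contMDiff_fst))) (n₀, (w n₀).1))
    (hb n₀) le_rfl
  have hev1 : ∀ᶠ n in nhds n₀, (w n).1 ∈
      (trivializationAt EP (TangentSpace IP : P → Type _) (w n₀).1).baseSet :=
    hb.continuous.continuousAt.preimage_mem_nhds ((trivializationAt EP _ _).open_baseSet.mem_nhds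
      (FiberBundle.mem_baseSet_trivializationAt' _))
  have hev2 : ∀ᶠ n in nhds n₀, B.κ (w n).1 (h n) ∈
      (trivializationAt EP (TangentSpace IP : P → Type _) (B.κ (w n₀).1 (h n₀))).baseSet :=
    hκ.continuous.continuousAt.preimage_mem_nhds ((trivializationAt EP _ _).open_baseSet.mem_nhds
      (FiberBundle.mem_baseSet_trivializationAt' _))
  have hcoord : ∀ᶠ n in nhds n₀, ∃ D : EP ≃L[ℝ] EP,
      inTangentCoordinates IP IP (fun n => (w n).1) (fun n => B.κ (w n).1 (h n))
        (fun n => mfderiv IP IP (fun q => B.κ q (h n)) (w n).1) n₀ n = D ∧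
      fibreCoord (B.κ (w n₀).1 (h n₀)) (B.cotangentLift (h n) (w n)) =
        (fibreCoord (w n₀).1 (w n)).comp (D.symm : EP →L[ℝ] EP) := by
    filter_upwards [hev1, hev2] with n h1 h2
    refine ⟨((trivializationAt EP (TangentSpace IP : P → Type _) (w n₀).1).continuousLinearEquivAt
      ℝ _ h1).symm.trans ((B.tangentRightEquiv (h n) (w n).1).trans
      ((trivializationAt EP (TangentSpace IP : P → Type _)
        (B.κ (w n₀).1 (h n₀))).continuousLinearEquivAt ℝ _ h2)), ?_, ?_⟩
    · unfold inTangentCoordinates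
      rw [ContinuousLinearMap.inCoordinates_eq h1 h2]
      rfl
    · rw [fibreCoord_eq, fibreCoord_eq]
      refine ContinuousLinearMap.ext fun v => ?_
      change (w n).2 ((B.tangentRight (h n) (w n).1).inverse _) = _
      rw [tangentRight_inverse]
      refine congrArg (w n).2 ?_
      have h3 (y : EP) := (congrFun (Trivialization.symm_continuousLinearEquivAt_eq (R := ℝ)
        (trivializationAt EP (TangentSpace IP : P → Type _) (w n₀).1) h1) y).symm
      have h4 := (congrFun (Trivialization.symm_continuousLinearEquivAt_eq (R := ℝ)
        (trivializationAt EP (TangentSpace IP : P → Type _) (B.κ (w n₀).1 (h n₀))) h2) v).symm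
      refine (congrArg (B.tangentRightEquiv (h n) (w n).1).symm h4).trans
        (Eq.trans ?_ (h3 _).symm)
      exact (((trivializationAt EP (TangentSpace IP : P → Type _)
        (w n₀).1).continuousLinearEquivAt ℝ _ h1).symm_apply_apply _).symm
  have hinv : ContDiffAt ℝ ∞ ContinuousLinearMap.inverse
      (inTangentCoordinates IP IP (fun n => (w n).1) (fun n => B.κ (w n).1 (h n))
        (fun n => mfderiv IP IP (fun q => B.κ q (h n)) (w n).1) n₀ n₀) := by
    obtain ⟨D, hD', -⟩ := hcoord.self_of_nhds
    rw [hD']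
    exact contDiffAt_map_inverse _
  refine ((contMDiffAt_cotangent.1 (hw n₀)).2.clm_comp
    (hinv.contMDiffAt.comp n₀ hD)).congr_of_eventuallyEq ?_
  filter_upwards [hcoord] with n ⟨D, hD', hD''⟩
  refine hD''.trans (congrArg (fun T => (fibreCoord (w n₀).1 (w n)).comp T) ?_)
  exact (ContinuousLinearMap.inverse_equiv D).symm.trans
    (congrArg ContinuousLinearMap.inverse hD'.symm)

theorem contMDiff_cotangentLift (g : G) :
    ContMDiff (cotModel IP) (cotModel IP) ∞ (B.cotangentLift g) :=
  B.contMDiff_cotangentLift_comp contMDiff_const contMDiff_id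

theorem contMDiff_cotangentOrbit [IsManifold IG ∞ G] (φ : CotangentBundle IP P) :
    ContMDiff IG (cotModel IP) ∞ (fun g => B.cotangentLift g φ) :=
  B.contMDiff_cotangentLift_comp contMDiff_id contMDiff_const

theorem mfderiv_cotProj_cotangentLift (g : G) (φ : CotangentBundle IP P)
    (w : TangentSpace (cotModel IP) φ) :
    mfderiv (cotModel IP) IP (cotProj IP P) (B.cotangentLift g φ)
      (mfderiv (cotModel IP) (cotModel IP) (B.cotangentLift g) φ w) =
    B.tangentRight g φ.1 (mfderiv (cotModel IP) IP (cotProj IP P) φ w) := by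
  have h := mfderiv_comp φ (mdifferentiableAt_cotProj (B.cotangentLift g φ))
    ((B.contMDiff_cotangentLift g).mdifferentiableAt (by simp))
  have h' := mfderiv_comp φ (B.mdifferentiableAt_right g φ.1) (mdifferentiableAt_cotProj φ)
  exact congrArg (fun T : EP × (EP →L[ℝ] ℝ) →L[ℝ] EP => T w) (h.symm.trans h')

theorem pullback_cotangentLift_Theta (A : FibreAut IP P) (g : G) (φ : CotangentBundle IP P)
    (w : TangentSpace (cotModel IP) φ) :
    OneForm.pullback (B.cotangentLift g) (Theta A) φ w =
      φ.2 ((B.tangentRightEquiv g φ.1).symm (A (B.κ φ.1 g) (B.tangentRight g φ.1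
        (mfderiv (cotModel IP) IP (cotProj IP P) φ w)))) := by
  have h := B.mfderiv_cotProj_cotangentLift g φ w
  have h' := B.tangentRight_inverse g φ.1
  exact (congrArg (fun u => φ.2 ((B.tangentRight g φ.1).inverse (A (B.κ φ.1 g) u))) h).trans
    (congrArg (fun T : TangentSpace IP (B.κ φ.1 g) →L[ℝ] TangentSpace IP φ.1 =>
      φ.2 (T (A (B.κ φ.1 g) (B.tangentRight g φ.1
        (mfderiv (cotModel IP) IP (cotProj IP P) φ w))))) h')

/-- The orbit map of `φ` lies over the orbit map `κ_p` of its base point. As `Θ(A)` sees only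
projections, this determines `J_A`. -/
theorem mfderiv_cotProj_cotangentFundamental [IsManifold IG ∞ G] (φ : CotangentBundle IP P)
    (X : GroupLieAlgebra IG G) :
    mfderiv (cotModel IP) IP (cotProj IP P) φ (B.cotangentFundamental φ X) =
      B.tangentOrbit φ.1 X := by
  have h := mfderiv_comp (1 : G) (mdifferentiableAt_cotProj (B.cotangentLift 1 φ))
    ((B.contMDiff_cotangentOrbit φ).mdifferentiableAt (by simp))
  have h1 := mfderiv_congr_base (I := cotModel IP) (I' := IP) (cotProj IP P)
    (B.cotangentLift_one φ)
    (mfderiv IG (cotModel IP) (fun g => B.cotangentLift g φ) (1 : G) X)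
  exact h1.symm.trans (congrArg (fun T : EG →L[ℝ] EP => T X) h).symm

theorem momentumMap_Theta [IsManifold IG ∞ G] (A : FibreAut IP P) :
    B.momentumMap (Theta A) = B.J0 ∘ A.dual := by
  funext φ
  refine ContinuousLinearMap.ext fun X => ?_
  exact congrArg (fun v => φ.2 (A φ.1 v)) (B.mfderiv_cotProj_cotangentFundamental φ X)

theorem momentumMap_Theta_eq_iff [IsManifold IG ∞ G] (A : FibreAut IP P) :
    B.momentumMap (Theta A) = B.J0 ↔
      ∀ (p : P) (X : GroupLieAlgebra IG G), A p (B.tangentOrbit p X) = B.tangentOrbit p X := by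
  rw [momentumMap_Theta]
  constructor
  · intro h p X
    refine ext_of_forall_cotangent fun η => ?_
    exact congrArg (fun J => J (TotalSpace.mk p η) X) h
  · intro h
    funext φ
    refine ContinuousLinearMap.ext fun X => ?_
    exact congrArg φ.2 (h φ.1 X)

theorem pullback_Theta_eq_iff [T2Space P] (A : FibreAut IP P) :
    (∀ g : G, OneForm.pullback (B.cotangentLift g) (Theta A) = Theta A) ↔
      ∀ (g : G) (p : P) (v : TangentSpace IP p),
        A (B.κ p g) (B.tangentRight g p v) = B.tangentRight g p (A p v) := by
  refine forall_congr' fun g => ⟨fun h p v => ?_, fun h => ?_⟩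
  · have h1 : (B.tangentRightEquiv g p).symm (A (B.κ p g) (B.tangentRight g p v)) = A p v := by
      refine ext_of_forall_cotangent fun η => ?_
      obtain ⟨w, rfl⟩ := mfderiv_cotProj_surjective (TotalSpace.mk p η : CotangentBundle IP P) v
      have h2 := congrArg (fun γ => γ (TotalSpace.mk p η) w) h
      exact (B.pullback_cotangentLift_Theta A g (TotalSpace.mk p η) w).symm.trans h2
    rw [ContinuousLinearEquiv.symm_apply_eq] at h1
    exact h1
  · funext φ
    refine ContinuousLinearMap.ext fun w => ?_
    exact (B.pullback_cotangentLift_Theta A g φ w).trans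
      (congrArg φ.2 ((ContinuousLinearEquiv.symm_apply_eq _).2 (h φ.1 _)))

theorem mem_AutTG_iff {A : FibreAut IP P} :
    A ∈ B.AutTG ↔ A ∈ Aut0 IP P ∧
      (∀ (g : G) (p : P) (v : TangentSpace IP p),
        A (B.κ p g) (B.tangentRight g p v) = B.tangentRight g p (A p v)) ∧
      ∀ (p : P) (X : GroupLieAlgebra IG G), A p (B.tangentOrbit p X) = B.tangentOrbit p X := by
  refine and_congr_right fun _ => ⟨fun h => ?_, fun h g X p v => ?_⟩
  · have h1 : ∀ (g : G) (p : P) (v : TangentSpace IP p),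
        A (B.κ p g) (B.tangentRight g p v) = B.tangentRight g p (A p v) := fun g p v => by
      have := h g 0 p v
      rwa [tangentAction_zero, tangentAction_zero] at this
    refine ⟨h1, fun p X => ?_⟩
    -- With `v = 0` and `g = e` both sides are images under the injective map `Tκ_e(p)`, which can
    -- be cancelled.
    have h2 := h 1 X p 0
    unfold tangentAction at h2
    rw [h1, ContinuousLinearEquiv.map_zero, zero_add] at h2
    exact (B.tangentRightEquiv 1 p).injective h2
  · unfold tangentAction
    rw [h.1, ContinuousLinearEquiv.map_add, h.2]

theorem Theta_mem_CanTG_iff [T2Space P] {A : FibreAut IP P} :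
    Theta A ∈ B.CanTG ↔ A ∈ B.AutTG :=
  Theta_injective.mem_set_image

end PrincipalBundle

end GenCan
end

theorem proposition6
    {EP : Type*} [NormedAddCommGroup EP] [NormedSpace ℝ EP] [FiniteDimensional ℝ EP]
    {HP : Type*} [TopologicalSpace HP] (IP : ModelWithCorners ℝ EP HP) [IP.Boundaryless]
    {EM : Type*} [NormedAddCommGroup EM] [NormedSpace ℝ EM] [FiniteDimensional ℝ EM]
    {HM : Type*} [TopologicalSpace HM] (IM : ModelWithCorners ℝ EM HM) [IM.Boundaryless]
    {EG : Type*} [NormedAddCommGroup EG] [NormedSpace ℝ EG] [FiniteDimensional ℝ EG]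
    {HG : Type*} [TopologicalSpace HG] (IG : ModelWithCorners ℝ EG HG) [IG.Boundaryless]
    (P : Type*) [TopologicalSpace P] [T2Space P] [ChartedSpace HP P] [IsManifold IP ∞ P]
    (M : Type*) [TopologicalSpace M] [T2Space M] [ChartedSpace HM M] [IsManifold IM ∞ M]
    (G : Type*) [TopologicalSpace G] [ChartedSpace HG G] [Group G] [LieGroup IG ∞ G]
    (B : PrincipalBundle IP IM IG P M G) :
    -- `Θ(A)` is a generalized canonical form, and its momentum map is `J_A = J₀ ∘ A^*`
    (∀ A ∈ Aut0 IP P, Theta A ∈ Can IP P ∧ B.momentumMap (Theta A) = B.J0 ∘ A.dual) ∧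
    -- (i)
    (∀ A ∈ Aut0 IP P, Theta A ∈ B.CanTG ↔
      ((∀ g : G, OneForm.pullback (B.cotangentLift g) (Theta A) = Theta A) ∧
        B.momentumMap (Theta A) = B.J0)) ∧
    -- (ii)
    (IsFreeActionOn (Aut0 IP P) (Can IP P) Lstar ∧
      B.CanTG = {γ | ∃ A ∈ B.AutTG, Lstar A (canonicalForm IP P) = γ}) ∧
    -- (iii)
    (∀ A ∈ Aut0 IP P, Set.MapsTo (Lstar A) B.CanTG B.CanTG → A ∈ B.AutTG) := by
  refine ⟨fun A hA => ⟨Theta_isGenCanonical hA, B.momentumMap_Theta A⟩, fun A hA => ?_,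
    ⟨⟨fun A hA γ hγ => Lstar_isGenCanonical hA hγ, fun γ _ => Lstar_one γ,
      fun A hA A' hA' γ _ => Lstar_mul hA hA' γ, fun A hA γ hγ h => eq_one_of_Lstar_eq hA hγ h⟩,
      ?_⟩, fun A hA h => ?_⟩
  · rw [B.Theta_mem_CanTG_iff, B.mem_AutTG_iff, and_iff_right hA, B.pullback_Theta_eq_iff,
      B.momentumMap_Theta_eq_iff]
  · ext γ
    refine exists_congr fun A => and_congr_right fun hA => ?_
    rw [Lstar_canonicalForm hA.1]
  -- Testing the inclusion on `γ₀ = Θ(1)` alone suffices, because its image is `Θ(A)`.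
  · have h1 := h ⟨1, one_mem _, Theta_one⟩
    rwa [Lstar_canonicalForm hA, B.Theta_mem_CanTG_iff] at h1
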